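/- Let $n\ge 0$, let $A,B\in M_n(\mathbb C)$ be positive definite (Hermitian) matrices, let $X\in M_n(\mathbb C)$ be arbitrary, and let $|||\cdot|||$ be a unitarily invariant norm on $M_n(\mathbb C)$, i.e. a norm with $|||UYV|||=|||Y|||$ for all $Y\in M_n(\mathbb C)$ and all unitary $U,V\in M_n(\mathbb C)$. Let $\alpha,\beta$ be real numbers with $0\le\alpha<\beta\le 1$. Then $$ \begin{aligned} 2\,|||A^{1/2}XB^{1/2}||| &\le \left|\left|\left|A^{\frac{\alpha+\beta}{2}}XB^{1-\frac{\alpha+\beta}{2}}+A^{1-\frac{\alpha+\beta}{2}}XB^{\frac{\alpha+\beta}{2}}\right|\right|\right|\\ &\le \frac{1}{|\beta-\alpha|}\left|\left|\left|\int_{\alpha}^{\beta}\left(A^{\nu}XB^{1-\nu}+A^{1-\nu}XB^{\nu}\right)d\nu\right|\right|\right|\\ &\le \frac12\left|\left|\left|A^{\alpha}XB^{1-\alpha}+A^{1-\alpha}XB^{\alpha}+A^{\beta}XB^{1-\beta}+A^{1-\beta}XB^{\beta}\right|\right|\right|\\ &\le \frac12\left|\left|\left|A^{\alpha}XB^{1-\alpha}+A^{1-\alpha}XB^{\alpha}\right|\right|\right|+\frac12\left|\left|\left|A^{\beta}XB^{1-\beta}+A^{1-\beta}XB^{\beta}\right|\right|\right|\\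 &\le |||AX+XB|||. \end{aligned} $$ -/

import Mathlib

open scoped ComplexOrder MatrixOrder

/-- A norm on `M_n(ℂ)` (a seminorm that vanishes only at `0`) with `|||U X V||| = |||X|||` for all
unitary `U`, `V`. -/
structure IsUnitarilyInvariantNorm {n : ℕ} (N : Seminorm ℂ (Matrix (Fin n) (Fin n) ℂ)) : Prop where
  eq_zero_of_map_eq_zero : ∀ X : Matrix (Fin n) (Fin n) ℂ, N X = 0 → X = 0
  map_unitary_mul_mul : ∀ U ∈ Matrix.unitaryGroup (Fin n) ℂ, ∀ V ∈ Matrix.unitaryGroup (Fin n) ℂ,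
    ∀ X : Matrix (Fin n) (Fin n) ℂ, N (U * X * V) = N X

/-- The Heinz expression `A^ν X B^(1-ν) + A^(1-ν) X B^ν`; the real powers of the matrices are those
of the continuous functional calculus. -/
noncomputable def heinz {n : ℕ} (A B X : Matrix (Fin n) (Fin n) ℂ) (ν : ℝ) :
    Matrix (Fin n) (Fin n) ℂ :=
  A ^ ν * X * B ^ (1 - ν) + A ^ (1 - ν) * X * B ^ ν

section

open scoped Matrix.Norms.L2Operator

/-- The matrix `∫_α^β (A^ν X B^(1-ν) + A^(1-ν) X B^ν) dν`, as a Bochner integral. (The operator norm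
serves only to supply the normed space structure; all norms on `M_n(ℂ)` give the same integral.) -/
noncomputable def heinzIntegral {n : ℕ} (A B X : Matrix (Fin n) (Fin n) ℂ) (α β : ℝ) :
    Matrix (Fin n) (Fin n) ℂ :=
  ∫ ν in α..β, heinz A B X ν

end

/-! In eigenbases of `A` and `B`, with eigenvalues `exp (s i)` and `exp (t j)`, every matrix in the
chain is the entrywise product of one fixed `Y` with an even function of `s i - t j`. The fourth
inequality is the triangle inequality; each of the others holds once the quotient of two such
kernels is a Schur contraction for `N`. Up to scaling, the quotients are `1 / sinhc x`, `sinhc x /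
cosh x` and `cosh (θ x) / cosh x` with `|θ| ≤ 1`.

Contractions are closed under products, convex combinations and pointwise limits. Unitary invariance
gives `cos`, a resolvent argument gives `1 / (1 + x ^ 2)`, hence `(1 + a x ^ 2) / (1 + b x ^ 2)` for
`0 ≤ a ≤ b`, and Euler products assemble these factors into the three quotients. -/

open Filter Topology in
theorem Seminorm.continuous_of_matrix {n : ℕ} (N : Seminorm ℂ (Matrix (Fin n) (Fin n) ℂ)) :
    Continuous N := by
  let _ : NormedAddCommGroup (Matrix (Fin n) (Fin n) ℂ) := Matrix.normedAddCommGroup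
  let _ : NormedSpace ℂ (Matrix (Fin n) (Fin n) ℂ) := Matrix.normedSpace
  let _ : NormedSpace ℝ (Matrix (Fin n) (Fin n) ℂ) := Matrix.normedSpace
  have _ : FiniteDimensional ℝ (Matrix (Fin n) (Fin n) ℂ) :=
    inferInstanceAs (FiniteDimensional ℝ (Fin n → Fin n → ℂ))
  have h : ConvexOn ℝ Set.univ N := by
    refine ⟨convex_univ, fun x _ y _ a b ha hb _ => ?_⟩
    have hs : ∀ (c : ℝ) (z : Matrix (Fin n) (Fin n) ℂ), 0 ≤ c → N (c • z) = c * N z := by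
      intro c z hc
      have : c • z = (c : ℂ) • z := by ext i j; simp
      rw [this, map_smul_eq_mul, Complex.norm_real, Real.norm_of_nonneg hc]
    calc N (a • x + b • y) ≤ N (a • x) + N (b • y) := map_add_le_add N _ _
      _ = a • N x + b • N y := by rw [hs a x ha, hs b y hb]; rfl
  exact continuousOn_univ.mp (h.continuousOn isOpen_univ)

/-- The matrix with entries `f (s i - t j) * Y i j`. -/
def schurMul {n : ℕ} (f : ℝ → ℝ) (s t : Fin n → ℝ) (Y : Matrix (Fin n) (Fin n) ℂ) :
    Matrix (Fin n) (Fin n) ℂ :=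
  Matrix.of fun i j => (f (s i - t j) : ℂ) * Y i j

/-- Schur multiplication by the kernels `f (s i - t j)` does not increase `N`. -/
def IsSchurContraction {n : ℕ} (N : Seminorm ℂ (Matrix (Fin n) (Fin n) ℂ)) (f : ℝ → ℝ) : Prop :=
  ∀ s t Y, N (schurMul f s t Y) ≤ N Y

/-! ### Calculus of Schur contractions -/

namespace IsSchurContraction

variable {n : ℕ} {N : Seminorm ℂ (Matrix (Fin n) (Fin n) ℂ)} {f g : ℝ → ℝ}

theorem one : IsSchurContraction N (fun _ => 1) := fun s t Y => by
  have : schurMul (fun _ => 1) s t Y = Y := by ext i j; simp [schurMul]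
  rw [this]

theorem mul (hf : IsSchurContraction N f) (hg : IsSchurContraction N g) :
    IsSchurContraction N (fun x => f x * g x) := fun s t Y => by
  have : schurMul (fun x => f x * g x) s t Y = schurMul f s t (schurMul g s t Y) := by
    ext i j; simp [schurMul, mul_assoc]
  rw [this]
  exact (hf s t _).trans (hg s t Y)

theorem prod {k : ℕ → ℝ → ℝ} (hk : ∀ j, IsSchurContraction N (k j)) (m : ℕ) :
    IsSchurContraction N (fun x => ∏ j ∈ Finset.range m, k j x) := by
  induction m with
  | zero => simpa using one
  | succ m ih => simpa only [Finset.prod_range_succ] using ih.mul (hk m)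

theorem convexComb (hf : IsSchurContraction N f) (hg : IsSchurContraction N g) {a b : ℝ}
    (ha : 0 ≤ a) (hb : 0 ≤ b) (hab : a + b = 1) :
    IsSchurContraction N (fun x => a * f x + b * g x) := fun s t Y => by
  have : schurMul (fun x => a * f x + b * g x) s t Y =
      (a : ℂ) • schurMul f s t Y + (b : ℂ) • schurMul g s t Y := by
    ext i j; simp [schurMul]; ring
  rw [this]
  refine (map_add_le_add N _ _).trans ?_
  rw [map_smul_eq_mul, map_smul_eq_mul, Complex.norm_real, Complex.norm_real,
    Real.norm_of_nonneg ha, Real.norm_of_nonneg hb]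
  calc a * N (schurMul f s t Y) + b * N (schurMul g s t Y) ≤ a * N Y + b * N Y := by
        gcongr
        · exact hf s t Y
        · exact hg s t Y
    _ = N Y := by rw [← add_mul, hab, one_mul]

theorem comp_mul_left (hf : IsSchurContraction N f) (c : ℝ) :
    IsSchurContraction N (fun x => f (c * x)) := fun s t Y => by
  have : schurMul (fun x => f (c * x)) s t Y =
      schurMul f (fun i => c * s i) (fun j => c * t j) Y := by
    ext i j; simp [schurMul, mul_sub]
  rw [this]
  exact hf _ _ Y

-- `N` is continuous and a matrix has finitely many entries, so pointwise convergence of kernels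
-- suffices.
open Filter Topology in
theorem of_tendsto {ι : Type*} {l : Filter ι} [l.NeBot] {k : ι → ℝ → ℝ}
    (hk : ∀ᶠ m in l, IsSchurContraction N (k m))
    (h : ∀ x, Tendsto (fun m => k m x) l (𝓝 (f x))) : IsSchurContraction N f := fun s t Y => by
  have h1 : Tendsto (fun m => schurMul (k m) s t Y) l (𝓝 (schurMul f s t Y)) := by
    refine tendsto_pi_nhds.mpr fun i => tendsto_pi_nhds.mpr fun j => ?_
    exact ((Complex.continuous_ofReal.tendsto _).comp (h _)).mul_const _
  refine le_of_tendsto ((N.continuous_of_matrix.tendsto _).comp h1) ?_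
  filter_upwards [hk] with m hm using hm s t Y

/-- The kernel `exp (± I (s i - t j))` acts by diagonal unitaries on the left and right, and `cos`
averages the two signs. -/
theorem cos (hN : IsUnitarilyInvariantNorm N) : IsSchurContraction N Real.cos := by
  intro s t Y
  have hU : ∀ r : Fin n → ℝ, Matrix.diagonal (fun i => Complex.exp (r i * Complex.I)) ∈
      Matrix.unitaryGroup (Fin n) ℂ := by
    intro r
    rw [Matrix.mem_unitaryGroup_iff, Matrix.star_eq_conjTranspose, Matrix.diagonal_conjTranspose,
      Matrix.diagonal_mul_diagonal, ← Matrix.diagonal_one]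
    congr 1
    ext i
    simp only [Pi.star_apply, RCLike.star_def, ← Complex.exp_conj, ← Complex.exp_add]
    simp
  have key : schurMul Real.cos s t Y = (1 / 2 : ℂ) •
      (Matrix.diagonal (fun i => Complex.exp (s i * Complex.I)) * Y *
          Matrix.diagonal (fun i => Complex.exp ((-t i : ℝ) * Complex.I)) +
        Matrix.diagonal (fun i => Complex.exp ((-s i : ℝ) * Complex.I)) * Y *
          Matrix.diagonal (fun i => Complex.exp (t i * Complex.I))) := by
    ext i j
    simp only [schurMul, Matrix.of_apply, Matrix.smul_apply, Matrix.add_apply,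
      Matrix.mul_diagonal, Matrix.diagonal_mul, smul_eq_mul]
    have h1 : Complex.exp ((s i - t j : ℂ) * Complex.I) =
        Complex.exp (s i * Complex.I) * Complex.exp ((-t j : ℝ) * Complex.I) := by
      rw [← Complex.exp_add]; congr 1; push_cast; ring
    have h2 : Complex.exp (-(s i - t j : ℂ) * Complex.I) =
        Complex.exp ((-s i : ℝ) * Complex.I) * Complex.exp (t j * Complex.I) := by
      rw [← Complex.exp_add]; congr 1; push_cast; ring
    rw [Complex.ofReal_cos, Complex.cos, Complex.ofReal_sub, h1, h2]
    ring
  rw [key, map_smul_eq_mul]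
  refine (mul_le_mul_of_nonneg_left (map_add_le_add N _ _) (norm_nonneg _)).trans ?_
  rw [hN.map_unitary_mul_mul _ (hU s) _ (hU fun i => -t i),
    hN.map_unitary_mul_mul _ (hU fun i => -s i) _ (hU t)]
  norm_num
  linarith

/-- A resolvent estimate: a contraction `f` yields the contraction `(1 + c (1 - f))⁻¹`. -/
theorem resolvent (hf : IsSchurContraction N f) {c : ℝ} (hc : 0 ≤ c)
    (h0 : ∀ x, 1 + c * (1 - f x) ≠ 0) :
    IsSchurContraction N (fun x => (1 + c * (1 - f x))⁻¹) := fun s t Y => by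
  set Z := schurMul (fun x => (1 + c * (1 - f x))⁻¹) s t Y with hZ
  -- Taking `N` gives `(1 + c) N Z ≤ N Y + c N Z`, and `c N Z` cancels.
  have key : ((1 + c : ℝ) : ℂ) • Z = Y + (c : ℂ) • schurMul f s t Z := by
    ext i j
    have h : (1 + (c : ℂ) * (1 - f (s i - t j))) ≠ 0 := by exact_mod_cast h0 (s i - t j)
    simp only [hZ, schurMul, Matrix.of_apply, Matrix.smul_apply, Matrix.add_apply, smul_eq_mul]
    push_cast
    field_simp
    ring
  have h1 := map_add_le_add N Y ((c : ℂ) • schurMul f s t Z)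
  rw [← key, map_smul_eq_mul, map_smul_eq_mul, Complex.norm_real, Complex.norm_real,
    Real.norm_of_nonneg hc, Real.norm_of_nonneg (by linarith)] at h1
  have h2 := mul_le_mul_of_nonneg_left (hf s t Z) hc
  linarith

-- Resolvents of `cos (h x)` with `c = 2 / h ^ 2`: as `h → 0`, `2 (1 - cos (h x)) / h ^ 2` tends to
-- `x ^ 2`.
open Filter Topology in
theorem inv_one_add_sq (hN : IsUnitarilyInvariantNorm N) :
    IsSchurContraction N (fun x => (1 + x ^ 2)⁻¹) := by
  refine of_tendsto (l := 𝓝[≠] (0 : ℝ))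
    (k := fun h x => (1 + 2 / h ^ 2 * (1 - Real.cos (h * x)))⁻¹) (.of_forall fun h => ?_)
    fun x => ?_
  · refine ((cos hN).comp_mul_left h).resolvent (by positivity) fun x => ?_
    have := Real.cos_le_one (h * x)
    have : 0 ≤ 2 / h ^ 2 * (1 - Real.cos (h * x)) := mul_nonneg (by positivity) (by linarith)
    linarith
  · refine Tendsto.inv₀ (tendsto_const_nhds.add ?_) (by positivity)
    have h1 : Tendsto (fun h : ℝ => (x * Real.sinc (h * x / 2)) ^ 2) (𝓝[≠] 0) (𝓝 (x ^ 2)) := by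
      have hc : Continuous fun h : ℝ => (x * Real.sinc (h * x / 2)) ^ 2 := by
        have := Real.continuous_sinc
        fun_prop
      simpa using (hc.tendsto 0).mono_left nhdsWithin_le_nhds
    refine h1.congr' ?_
    filter_upwards [self_mem_nhdsWithin] with h hh
    have hh : h ≠ 0 := hh
    have h2 : Real.cos (h * x) = 1 - 2 * Real.sin (h * x / 2) ^ 2 := by
      have := Real.cos_two_mul (h * x / 2)
      have h3 := Real.sin_sq_add_cos_sq (h * x / 2)
      rw [mul_div_cancel₀ _ (two_ne_zero)] at this
      linarith
    rcases eq_or_ne x 0 with rfl | hx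
    · simp
    · rw [h2, Real.sinc_of_ne_zero (by positivity)]
      field_simp
      ring

/-- A convex combination of `1` and `1 / (1 + b x ^ 2)` with weights `a / b` and `1 - a / b`. -/
theorem div_one_add_sq (hN : IsUnitarilyInvariantNorm N) {a b : ℝ} (ha : 0 ≤ a) (hab : a ≤ b)
    (hb : 0 < b) : IsSchurContraction N (fun x => (1 + a * x ^ 2) / (1 + b * x ^ 2)) := by
  have h := one.convexComb ((inv_one_add_sq hN).comp_mul_left √b) (a := a / b) (b := 1 - a / b)
    (by positivity) (sub_nonneg.mpr ((div_le_one hb).mpr hab)) (by ring)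
  convert h using 2 with x
  rw [mul_pow, Real.sq_sqrt hb.le]
  have : 1 + b * x ^ 2 ≠ 0 := by positivity
  field_simp
  ring

open Filter Topology in
/-- A quotient of two even infinite products whose zeros on the imaginary axis interlace. -/
theorem of_tendsto_prod (hN : IsUnitarilyInvariantNorm N) {a b : ℕ → ℝ} (ha : ∀ j, 0 ≤ a j)
    (hab : ∀ j, a j ≤ b j) (hb : ∀ j, 0 < b j)
    (hf : ∀ x, Tendsto (fun m => ∏ j ∈ Finset.range m, (1 + a j * x ^ 2)) atTop (𝓝 (f x)))
    (hg : ∀ x, Tendsto (fun m => ∏ j ∈ Finset.range m, (1 + b j * x ^ 2)) atTop (𝓝 (g x)))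
    (hg0 : ∀ x, g x ≠ 0) : IsSchurContraction N (fun x => f x / g x) := by
  refine of_tendsto (l := atTop)
    (.of_forall fun m => prod (fun j => div_one_add_sq hN (ha j) (hab j) (hb j)) m) fun x => ?_
  simp only [Finset.prod_div_distrib]
  exact (hf x).div (hg x) (hg0 x)

end IsSchurContraction

/-! ### Euler products for `sinhc` and `cosh` -/

/-- The function `sinh x / x`, extended by `1` at `0`. -/
noncomputable def sinhc (x : ℝ) : ℝ := if x = 0 then 1 else Real.sinh x / x

theorem mul_sinhc (x : ℝ) : x * sinhc x = Real.sinh x := by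
  unfold sinhc
  split_ifs with h
  · simp [h]
  · field_simp

theorem sinhc_pos (x : ℝ) : 0 < sinhc x := by
  unfold sinhc
  split_ifs with h
  · exact one_pos
  · rcases lt_or_gt_of_ne h with h | h
    · exact div_pos_of_neg_of_neg (Real.sinh_neg_iff.mpr h) h
    · exact div_pos (Real.sinh_pos_iff.mpr h) h

theorem sinhc_two_mul (x : ℝ) : sinhc (2 * x) = sinhc x * Real.cosh x := by
  rcases eq_or_ne x 0 with rfl | h
  · simp [sinhc]
  · have h2 : 2 * x ≠ 0 := mul_ne_zero two_ne_zero h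
    apply mul_left_cancel₀ h2
    rw [mul_sinhc, Real.sinh_two_mul, ← mul_sinhc]
    ring

-- Euler's sine product at the imaginary point `x * I`, divided by `π x I`.
open Filter Topology in
theorem tendsto_prod_sinhc (x : ℝ) :
    Tendsto (fun m : ℕ => ∏ j ∈ Finset.range m, (1 + 1 / ((j : ℝ) + 1) ^ 2 * x ^ 2)) atTop
      (𝓝 (sinhc (Real.pi * x))) := by
  rcases eq_or_ne x 0 with rfl | hx
  · simp [sinhc]
  have hpx : Real.pi * x ≠ 0 := mul_ne_zero Real.pi_ne_zero hx
  have h := Complex.tendsto_euler_sin_prod (x * Complex.I)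
  rw [← mul_assoc, Complex.sin_mul_I] at h
  have h2 := (Complex.continuous_re.tendsto _).comp (h.const_mul (-Complex.I / (Real.pi * x)))
  have hx' : (x : ℂ) ≠ 0 := by exact_mod_cast hx
  have hp' : (Real.pi : ℂ) ≠ 0 := by exact_mod_cast Real.pi_ne_zero
  convert h2 using 1
  · ext m
    have : -Complex.I / (Real.pi * x) * (Real.pi * x * Complex.I *
        ∏ j ∈ Finset.range m, (1 - (x * Complex.I) ^ 2 / ((j : ℂ) + 1) ^ 2)) =
        ((∏ j ∈ Finset.range m, (1 + 1 / ((j : ℝ) + 1) ^ 2 * x ^ 2) : ℝ) : ℂ) := by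
      have hP : ∀ P : ℂ, -Complex.I / (Real.pi * x) * (Real.pi * x * Complex.I * P) = P := by
        intro P
        field_simp
        linear_combination (-P) * Complex.I_sq
      rw [hP]
      push_cast
      refine Finset.prod_congr rfl fun j _ => ?_
      rw [mul_pow, Complex.I_sq]
      ring
    rw [Function.comp_apply, this, Complex.ofReal_re]
  · congr 1
    have : -Complex.I / (Real.pi * x) * (Complex.sinh (Real.pi * x) * Complex.I) =
        ((Real.sinh (Real.pi * x) / (Real.pi * x) : ℝ) : ℂ) := by
      push_cast
      field_simp
      linear_combination (-Complex.sinh (Real.pi * x)) * Complex.I_sq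
    rw [this, Complex.ofReal_re, sinhc, if_neg hpx]

-- Since `cosh y = sinhc (2 y) / sinhc y`, take `2 m` factors of the numerator against `m` of the
-- denominator: the odd-indexed factors cancel.
open Filter Topology in
theorem tendsto_prod_cosh (x : ℝ) :
    Tendsto (fun m : ℕ => ∏ j ∈ Finset.range m, (1 + 4 / (2 * (j : ℝ) + 1) ^ 2 * x ^ 2)) atTop
      (𝓝 (Real.cosh (Real.pi * x))) := by
  have h1 := (tendsto_prod_sinhc (2 * x)).comp (tendsto_id.const_mul_atTop' (r := 2) two_pos)
  have h2 := h1.div (tendsto_prod_sinhc x) (sinhc_pos _).ne'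
  have h3 : sinhc (Real.pi * (2 * x)) / sinhc (Real.pi * x) = Real.cosh (Real.pi * x) := by
    rw [show Real.pi * (2 * x) = 2 * (Real.pi * x) by ring, sinhc_two_mul,
      mul_div_cancel_left₀ _ (sinhc_pos _).ne']
  rw [h3] at h2
  refine h2.congr fun m => ?_
  have hpair : ∀ F : ℕ → ℝ, ∏ j ∈ Finset.range (2 * m), F j =
      ∏ j ∈ Finset.range m, (F (2 * j) * F (2 * j + 1)) := by
    intro F
    induction m with
    | zero => simp
    | succ m ih =>
      rw [Nat.mul_succ, Finset.prod_range_succ, Finset.prod_range_succ, ih,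
        Finset.prod_range_succ, mul_assoc]
  simp only [Pi.div_apply, Function.comp_apply, id, hpair]
  rw [← Finset.prod_div_distrib]
  refine Finset.prod_congr rfl fun j _ => ?_
  have h4 : 1 + 1 / ((j : ℝ) + 1) ^ 2 * x ^ 2 ≠ 0 := by positivity
  rw [div_eq_iff h4, mul_pow]
  push_cast
  congr 1
  · ring
  · congr 1
    field_simp
    ring

/-! ### The three quotient kernels -/

namespace IsSchurContraction

variable {n : ℕ} {N : Seminorm ℂ (Matrix (Fin n) (Fin n) ℂ)}

theorem of_pi_mul {f : ℝ → ℝ} (h : IsSchurContraction N (fun x => f (Real.pi * x))) :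
    IsSchurContraction N f := by
  have := h.comp_mul_left Real.pi⁻¹
  simpa [mul_inv_cancel_left₀ Real.pi_ne_zero] using this

theorem inv_sinhc (hN : IsUnitarilyInvariantNorm N) :
    IsSchurContraction N (fun x => 1 / sinhc x) := by
  refine of_pi_mul (of_tendsto_prod hN (f := fun _ => 1) (a := fun _ => 0)
    (b := fun j => 1 / ((j : ℝ) + 1) ^ 2) (fun j => le_rfl) (fun j => by positivity)
    (fun j => by positivity) (fun x => by simp) tendsto_prod_sinhc fun x => (sinhc_pos _).ne')

theorem sinhc_div_cosh (hN : IsUnitarilyInvariantNorm N) :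
    IsSchurContraction N (fun x => sinhc x / Real.cosh x) := by
  refine of_pi_mul (of_tendsto_prod hN (a := fun j => 1 / ((j : ℝ) + 1) ^ 2)
    (b := fun j => 4 / (2 * (j : ℝ) + 1) ^ 2) (fun j => by positivity) (fun j => ?_)
    (fun j => by positivity) tendsto_prod_sinhc tendsto_prod_cosh fun x => (Real.cosh_pos _).ne')
  -- Each zero of `cosh` on the imaginary axis precedes the corresponding zero of `sinhc`: `j + 1 /
  -- 2 ≤ j + 1` in units of `π`.
  rw [div_le_div_iff₀ (by positivity) (by positivity)]
  have : (0 : ℝ) ≤ j := j.cast_nonneg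
  nlinarith

theorem cosh_mul_div_cosh (hN : IsUnitarilyInvariantNorm N) {θ : ℝ} (hθ : θ ^ 2 ≤ 1) :
    IsSchurContraction N (fun x => Real.cosh (θ * x) / Real.cosh x) := by
  refine of_pi_mul (of_tendsto_prod hN (a := fun j => θ ^ 2 * (4 / (2 * (j : ℝ) + 1) ^ 2))
    (b := fun j => 4 / (2 * (j : ℝ) + 1) ^ 2) (fun j => by positivity)
    (fun j => mul_le_of_le_one_left (by positivity) hθ)
    (fun j => by positivity) (fun x => ?_) tendsto_prod_cosh fun x => (Real.cosh_pos _).ne')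
  have h := tendsto_prod_cosh (θ * x)
  rw [mul_left_comm] at h
  refine h.congr fun m => Finset.prod_congr rfl fun j _ => ?_
  ring

end IsSchurContraction

/-! ### Heinz expressions as Schur multiplications -/

/-- A positive definite matrix is unitarily diagonalizable, compatibly with real powers. -/
theorem Matrix.PosDef.exists_rpow_eq {n : ℕ} {A : Matrix (Fin n) (Fin n) ℂ} (hA : A.PosDef) :
    ∃ U ∈ Matrix.unitaryGroup (Fin n) ℂ, ∃ s : Fin n → ℝ, ∀ ν : ℝ,
      A ^ ν = U * Matrix.diagonal (fun i => (Real.exp (ν * s i) : ℂ)) * star U := by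
  refine ⟨hA.1.eigenvectorUnitary, hA.1.eigenvectorUnitary.2,
    fun i => Real.log (hA.1.eigenvalues i), fun ν => ?_⟩
  rw [CFC.rpow_eq_cfc_real (Matrix.nonneg_iff_posSemidef.mpr hA.posSemidef), hA.1.cfc_eq,
    Matrix.IsHermitian.cfc, Unitary.conjStarAlgAut_apply]
  congr 3
  ext i
  simp [Real.rpow_def_of_pos (hA.eigenvalues_pos i), mul_comm]

/-- The Heinz kernel of mean `ν`, divided by the geometric mean, as a function of the difference of
the logarithms. -/
noncomputable def heinzKernel (ν x : ℝ) : ℝ := 2 * Real.cosh ((2 * ν - 1) * (x / 2))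

theorem exp_add_exp_eq_heinzKernel (ν s t : ℝ) :
    Real.exp (ν * s) * Real.exp ((1 - ν) * t) + Real.exp ((1 - ν) * s) * Real.exp (ν * t) =
      heinzKernel ν (s - t) * Real.exp ((s + t) / 2) := by
  rw [heinzKernel, Real.cosh_eq, mul_div_cancel₀ _ two_ne_zero, add_mul, ← Real.exp_add,
    ← Real.exp_add, ← Real.exp_add, ← Real.exp_add]
  congr 2 <;> ring

/-- Isolates the midpoint kernel as a common factor, via `sinh (p + q) - sinh (p - q) = 2 cosh p
sinh q`. -/
theorem integral_heinzKernel {α β : ℝ} (x : ℝ) :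
    ∫ ν in α..β, heinzKernel ν x =
      (β - α) * (heinzKernel ((α + β) / 2) x * sinhc ((β - α) * (x / 2))) := by
  rcases eq_or_ne x 0 with rfl | hx
  · simp [heinzKernel, sinhc]
  have hd : ∀ ν ∈ Set.uIcc α β, HasDerivAt
      (fun ν => 2 / x * Real.sinh ((2 * ν - 1) * (x / 2))) (heinzKernel ν x) ν := by
    intro ν _
    have h1 : HasDerivAt (fun ν : ℝ => (2 * ν - 1) * (x / 2)) (2 * 1 * (x / 2)) ν :=
      (((hasDerivAt_id ν).const_mul 2).sub_const 1).mul_const _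
    refine (h1.sinh.const_mul (2 / x)).congr_deriv ?_
    unfold heinzKernel
    field_simp
  rw [intervalIntegral.integral_eq_sub_of_hasDerivAt hd
    (Continuous.intervalIntegrable (by unfold heinzKernel; fun_prop) _ _)]
  have h2 : (2 * β - 1) * (x / 2) = (α + β - 1) * (x / 2) + (β - α) * (x / 2) := by ring
  have h3 : (2 * α - 1) * (x / 2) = (α + β - 1) * (x / 2) - (β - α) * (x / 2) := by ring
  rw [h2, h3, Real.sinh_add, Real.sinh_sub, ← mul_sinhc ((β - α) * (x / 2)), heinzKernel,
    mul_div_cancel₀ _ two_ne_zero]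
  field_simp
  ring

theorem heinzKernel_add (α β x : ℝ) :
    heinzKernel α x + heinzKernel β x =
      2 * (heinzKernel ((α + β) / 2) x * Real.cosh ((β - α) * (x / 2))) := by
  have h2 : (2 * β - 1) * (x / 2) = (α + β - 1) * (x / 2) + (β - α) * (x / 2) := by ring
  have h3 : (2 * α - 1) * (x / 2) = (α + β - 1) * (x / 2) - (β - α) * (x / 2) := by ring
  rw [heinzKernel, heinzKernel, heinzKernel, h2, h3, Real.cosh_add, Real.cosh_sub,
    mul_div_cancel₀ _ two_ne_zero]
  ring

/-- In eigenbases of `A` and `B`, the Heinz expression is a Schur multiplication. -/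
theorem exists_heinz_eq_schurMul {n : ℕ} {A B : Matrix (Fin n) (Fin n) ℂ} (hA : A.PosDef)
    (hB : B.PosDef) (X : Matrix (Fin n) (Fin n) ℂ) :
    ∃ U ∈ Matrix.unitaryGroup (Fin n) ℂ, ∃ V ∈ Matrix.unitaryGroup (Fin n) ℂ,
      ∃ s t : Fin n → ℝ, ∃ Y : Matrix (Fin n) (Fin n) ℂ,
        ∀ ν, star U * heinz A B X ν * V = schurMul (heinzKernel ν) s t Y := by
  obtain ⟨U, hU, s, hs⟩ := hA.exists_rpow_eq
  obtain ⟨V, hV, t, ht⟩ := hB.exists_rpow_eq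
  refine ⟨U, hU, V, hV, s, t,
    -- The geometric mean of the eigenvalues does not depend on `ν`, so it is absorbed into `Y`.
    Matrix.of fun i j => (Real.exp ((s i + t j) / 2) : ℂ) * (star U * X * V) i j, fun ν => ?_⟩
  have hU' : star U * U = 1 := Matrix.mem_unitaryGroup_iff'.mp hU
  have hV' : star V * V = 1 := Matrix.mem_unitaryGroup_iff'.mp hV
  have hterm : ∀ D E : Matrix (Fin n) (Fin n) ℂ,
      star U * (U * D * star U * X * (V * E * star V)) * V = D * (star U * X * V) * E := by
    intro D E
    calc _ = (star U * U) * D * (star U * X * V) * E * (star V * V) := by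
          simp only [Matrix.mul_assoc]
      _ = _ := by rw [hU', hV', Matrix.one_mul, Matrix.mul_one]
  rw [heinz, hs, hs, ht, ht, Matrix.mul_add, Matrix.add_mul, hterm, hterm]
  ext i j
  have h := congrArg (Complex.ofReal) (exp_add_exp_eq_heinzKernel ν (s i) (t j))
  push_cast at h
  simp only [schurMul, Matrix.add_apply, Matrix.mul_diagonal, Matrix.diagonal_mul,
    Matrix.of_apply]
  push_cast
  linear_combination ((star U * X * V) i j) * h

section

open scoped Matrix.Norms.L2Operator

theorem heinzIntegral_eq_schurMul {n : ℕ} {A B X U V Y : Matrix (Fin n) (Fin n) ℂ}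
    (hU : U ∈ Matrix.unitaryGroup (Fin n) ℂ) (hV : V ∈ Matrix.unitaryGroup (Fin n) ℂ)
    {s t : Fin n → ℝ} (h : ∀ ν, star U * heinz A B X ν * V = schurMul (heinzKernel ν) s t Y)
    (α β : ℝ) :
    star U * heinzIntegral A B X α β * V =
      schurMul (fun x => ∫ ν in α..β, heinzKernel ν x) s t Y := by
  have hU' : U * star U = 1 := Matrix.mem_unitaryGroup_iff.mp hU
  have hV' : V * star V = 1 := Matrix.mem_unitaryGroup_iff.mp hV
  have hheinz : heinz A B X = fun ν => U * schurMul (heinzKernel ν) s t Y * star V := by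
    funext ν
    calc heinz A B X ν = (U * star U) * heinz A B X ν * (V * star V) := by
          rw [hU', hV', Matrix.one_mul, Matrix.mul_one]
      _ = U * (star U * heinz A B X ν * V) * star V := by simp only [Matrix.mul_assoc]
      _ = _ := by rw [h]
  have hcont : Continuous (heinz A B X) := by
    have : Continuous fun ν => schurMul (heinzKernel ν) s t Y := by
      refine continuous_pi fun i => continuous_pi fun j => ?_
      unfold schurMul heinzKernel
      simp only [Matrix.of_apply]
      fun_prop
    rw [hheinz]
    exact (continuous_const.mul this).mul continuous_const
  ext i j
  -- A linear functional in finite dimension is continuous, so it passes through the Bochner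
  -- integral.
  let φ : Matrix (Fin n) (Fin n) ℂ →ₗ[ℂ] ℂ :=
    { toFun := fun M => (star U * M * V) i j
      map_add' := fun M M' => by simp [Matrix.mul_add, Matrix.add_mul]
      map_smul' := fun c M => by simp }
  have h1 := ContinuousLinearMap.intervalIntegral_comp_comm (LinearMap.toContinuousLinearMap φ)
    (hcont.intervalIntegrable (μ := MeasureTheory.volume) α β)
  calc (star U * heinzIntegral A B X α β * V) i j
      = ∫ ν in α..β, (star U * heinz A B X ν * V) i j := h1.symm
    _ = ∫ ν in α..β, ((heinzKernel ν (s i - t j) : ℝ) : ℂ) * Y i j := by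
        simp only [h, schurMul, Matrix.of_apply]
    _ = _ := by
        rw [intervalIntegral.integral_mul_const, intervalIntegral.integral_ofReal]
        rfl

end

/-! ### Comparison of norms -/

theorem schurMul_add {n : ℕ} (f g : ℝ → ℝ) (s t : Fin n → ℝ) (Y : Matrix (Fin n) (Fin n) ℂ) :
    schurMul f s t Y + schurMul g s t Y = schurMul (fun x => f x + g x) s t Y := by
  ext i j
  simp [schurMul, add_mul]

theorem map_schurMul_const_mul {n : ℕ} (N : Seminorm ℂ (Matrix (Fin n) (Fin n) ℂ)) {c : ℝ}
    (hc : 0 ≤ c) (f : ℝ → ℝ) (s t : Fin n → ℝ) (Y : Matrix (Fin n) (Fin n) ℂ) :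
    N (schurMul (fun x => c * f x) s t Y) = c * N (schurMul f s t Y) := by
  have : schurMul (fun x => c * f x) s t Y = (c : ℂ) • schurMul f s t Y := by
    ext i j; simp [schurMul, mul_assoc]
  rw [this, map_smul_eq_mul, Complex.norm_real, Real.norm_of_nonneg hc]

theorem IsSchurContraction.map_schurMul_le {n : ℕ}
    {N : Seminorm ℂ (Matrix (Fin n) (Fin n) ℂ)} {k f g : ℝ → ℝ} (hk : IsSchurContraction N k)
    (h : ∀ x, f x = k x * g x) (s t : Fin n → ℝ) (Y : Matrix (Fin n) (Fin n) ℂ) :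
    N (schurMul f s t Y) ≤ N (schurMul g s t Y) := by
  have : schurMul f s t Y = schurMul k s t (schurMul g s t Y) := by
    ext i j; simp [schurMul, h, mul_assoc]
  rw [this]
  exact hk s t _

/-- The norm grows with the distance of the exponent from `1 / 2`: the kernel quotient is `cosh (θ
y) / cosh y` with `θ = (2 μ - 1) / (2 ν - 1)`. -/
theorem map_heinz_le_map_heinz {n : ℕ} {N : Seminorm ℂ (Matrix (Fin n) (Fin n) ℂ)}
    (hN : IsUnitarilyInvariantNorm N) {μ ν : ℝ} (h : (2 * μ - 1) ^ 2 ≤ (2 * ν - 1) ^ 2)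
    (s t : Fin n → ℝ) (Y : Matrix (Fin n) (Fin n) ℂ) :
    N (schurMul (heinzKernel μ) s t Y) ≤ N (schurMul (heinzKernel ν) s t Y) := by
  have hθ : ((2 * μ - 1) / (2 * ν - 1)) ^ 2 ≤ 1 := by
    rw [div_pow]
    exact div_le_one_of_le₀ h (sq_nonneg _)
  refine ((IsSchurContraction.cosh_mul_div_cosh hN hθ).comp_mul_left
    ((2 * ν - 1) / 2)).map_schurMul_le (fun x => ?_) s t Y
  have hx : (2 * μ - 1) / (2 * ν - 1) * ((2 * ν - 1) / 2 * x) = (2 * μ - 1) * (x / 2) := by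
    -- For `ν = 1 / 2` division by zero makes `θ = 0`, which is harmless because `μ = 1 / 2` is then
    -- forced.
    rcases eq_or_ne (2 * ν - 1) 0 with h0 | h0
    · have : 2 * μ - 1 = 0 := by
        rw [h0] at h
        exact pow_eq_zero_iff two_ne_zero |>.mp (le_antisymm (by simpa using h) (sq_nonneg _))
      simp [this]
    · field_simp
  have hx' : (2 * ν - 1) / 2 * x = (2 * ν - 1) * (x / 2) := by ring
  have := (Real.cosh_pos ((2 * ν - 1) * (x / 2))).ne'
  rw [hx, hx', heinzKernel, heinzKernel]
  field_simp

theorem mainTheorem3 (n : ℕ) (A B X : Matrix (Fin n) (Fin n) ℂ) (hA : A.PosDef) (hB : B.PosDef)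
    (N : Seminorm ℂ (Matrix (Fin n) (Fin n) ℂ)) (hN : IsUnitarilyInvariantNorm N)
    (α β : ℝ) (hα : 0 ≤ α) (hαβ : α < β) (hβ : β ≤ 1) :
    2 * N (A ^ (1 / 2 : ℝ) * X * B ^ (1 / 2 : ℝ)) ≤ N (heinz A B X ((α + β) / 2)) ∧
    N (heinz A B X ((α + β) / 2)) ≤ 1 / |β - α| * N (heinzIntegral A B X α β) ∧
    1 / |β - α| * N (heinzIntegral A B X α β) ≤
      1 / 2 * N (heinz A B X α + heinz A B X β) ∧
    1 / 2 * N (heinz A B X α + heinz A B X β) ≤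
      1 / 2 * N (heinz A B X α) + 1 / 2 * N (heinz A B X β) ∧
    1 / 2 * N (heinz A B X α) + 1 / 2 * N (heinz A B X β) ≤ N (A * X + X * B) := by
  obtain ⟨U, hU, V, hV, s, t, Y, h⟩ := exists_heinz_eq_schurMul hA hB X
  have hδ : 0 < β - α := sub_pos.mpr hαβ
  have hinv : ∀ M, N M = N (star U * M * V) := fun M =>
    (hN.map_unitary_mul_mul _ (Unitary.star_mem hU) _ hV M).symm
  have hheinz : ∀ ν, N (heinz A B X ν) = N (schurMul (heinzKernel ν) s t Y) := fun ν => by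
    rw [hinv, h]
  have hhalf : 2 * N (A ^ (1 / 2 : ℝ) * X * B ^ (1 / 2 : ℝ)) = N (heinz A B X (1 / 2)) := by
    rw [heinz, show (1 - 1 / 2 : ℝ) = 1 / 2 by norm_num, ← two_smul ℂ, map_smul_eq_mul]
    norm_num
  have hone : A * X + X * B = heinz A B X 1 := by
    have hA0 := Matrix.nonneg_iff_posSemidef.mpr hA.posSemidef
    have hB0 := Matrix.nonneg_iff_posSemidef.mpr hB.posSemidef
    rw [heinz, sub_self, CFC.rpow_one A hA0, CFC.rpow_one B hB0, CFC.rpow_zero A hA0,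
      CFC.rpow_zero B hB0, Matrix.mul_one, Matrix.one_mul]
  have hint : 1 / |β - α| * N (heinzIntegral A B X α β) =
      N (schurMul (fun x => heinzKernel ((α + β) / 2) x * sinhc ((β - α) * (x / 2))) s t Y) := by
    rw [hinv, heinzIntegral_eq_schurMul hU hV h]
    simp only [integral_heinzKernel]
    rw [map_schurMul_const_mul N hδ.le, abs_of_pos hδ]
    field_simp
  have hsum : 1 / 2 * N (heinz A B X α + heinz A B X β) =
      N (schurMul (fun x => heinzKernel ((α + β) / 2) x * Real.cosh ((β - α) * (x / 2)))
        s t Y) := by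
    rw [hinv, Matrix.mul_add, Matrix.add_mul, h, h, schurMul_add]
    simp only [heinzKernel_add]
    rw [map_schurMul_const_mul N zero_le_two]
    ring
  have hx : ∀ x : ℝ, (β - α) / 2 * x = (β - α) * (x / 2) := fun x => by ring
  refine ⟨?_, ?_, ?_, ?_, ?_⟩
  · rw [hhalf, hheinz, hheinz]
    exact map_heinz_le_map_heinz hN (by norm_num; positivity) s t Y
  · rw [hint, hheinz]
    refine ((IsSchurContraction.inv_sinhc hN).comp_mul_left ((β - α) / 2)).map_schurMul_le
      (fun x => ?_) s t Y
    rw [hx, mul_left_comm, one_div_mul_cancel (sinhc_pos _).ne', mul_one]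
  · rw [hint, hsum]
    refine ((IsSchurContraction.sinhc_div_cosh hN).comp_mul_left ((β - α) / 2)).map_schurMul_le
      (fun x => ?_) s t Y
    have := (Real.cosh_pos ((β - α) * (x / 2))).ne'
    rw [hx]
    field_simp
  · have := map_add_le_add N (heinz A B X α) (heinz A B X β)
    linarith
  -- The exponent `1` is at maximal distance from `1 / 2` in `[0, 1]`.
  · have h1 : ∀ ν, 0 ≤ ν → ν ≤ 1 → N (heinz A B X ν) ≤ N (A * X + X * B) := by
      intro ν h0 h1
      rw [hone, hheinz, hheinz]
      exact map_heinz_le_map_heinz hN (by nlinarith) s t Y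
    have h2 := h1 α hα (by linarith)
    have h3 := h1 β (by linarith) hβ
    linarith
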